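/- Let $x_{ij}$ ($1\le i\le I$, $1\le j\le k$) be real constants such that the design matrix $X$, whose $i$-th row is $x_i^T=(1,x_{i1},\dots,x_{ik})$, has full rank $k+1$. For $\beta\in\mathbb R^{k+1}$ let $\pi(\beta)=(\pi_1(\beta),\dots,\pi_I(\beta))^T$ with $\pi_i(\beta)=\exp(x_i^T\beta)/(1+\exp(x_i^T\beta))$. Let $N_1,\dots,N_I>0$ be the domain sizes, $N=\sum_i N_i$, $W_i=N_i/N$ and $W=(W_1,\dots,W_I)^T$; let $\beta_0\in\mathbb R^{k+1}$ be the true parameter and $V$ a symmetric positive semidefinite $I\times I$ matrix. For each sample size $n$ let $\widehat N_i$ and $\widehat N_{i1}$ (the survey estimators of the size of domain $i$ and of its number of successes) be random variables with $0\le\widehat N_{i1}\le\widehat N_i$ almost surely, and put $w_i=\widehat N_i/\sum_j\widehat N_j$, $\widehat p_i=\widehat N_{i1}/\widehat N_i$, $w=(w_i)_i$, $\widehat p=(\widehat p_i)_i$. Let $\varphi:(0,\infty)\to\mathbb R$ be convex with $\varphi(1)=\varphi'(1)=0$ and with a second derivative at $1$ satisfying $\varphi''(1)>0$; put $\varphi(0)=\lim_{u\downarrow0}\varphi(u)\in[0,\infty]$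 and $$D_n(\beta)=\sum_{i=1}^I w_i\Big[\pi_i(\beta)\,\varphi\Big(\frac{\widehat p_i}{\pi_i(\beta)}\Big)+(1-\pi_i(\beta))\,\varphi\Big(\frac{1-\widehat p_i}{1-\pi_i(\beta)}\Big)\Big]$$ (terms with $w_i=0$ are $0$). Let the pseudo minimum $\varphi$-divergence estimator $\widehat\beta_{\varphi,P}$ be a random vector in $\mathbb R^{k+1}$ that almost surely minimizes $D_n$ over $\mathbb R^{k+1}$ whenever a minimizer exists. Suppose that, as $n\to\infty$, $w\to W$ and $\widehat p\to\pi(\beta_0)$ in probability and $\sqrt n\,(\widehat p-\pi(\beta_0))\to\mathcal N(0,V)$ in law. Then, with $\Delta=\mathrm{diag}\big(W_i\,\pi_i(\beta_0)(1-\pi_i(\beta_0))\big)_{i=1}^I$, the matrix $X^T\Delta X$ is invertible and $$\sqrt n\,(\widehat\beta_{\varphi,P}-\beta_0)\to\mathcal N\Big(0,\ (X^T\Delta X)^{-1}X^T\mathrm{diag}(W)\,V\,\mathrm{diag}(W)\,X\,(X^T\Delta X)^{-1}\Big)\quad\text{in law.}$$ In particular the limit does not depend on $\varphi$. -/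

import Mathlib

open MeasureTheory ProbabilityTheory Filter Matrix
open scoped Topology ENNReal

noncomputable section

namespace PseudoPhi

/-- The class `Φ` of divergence functions: `φ` is convex on `(0, ∞)`, with `φ 1 = φ' 1 = 0` and a
second derivative at `1` that is positive. (A nonzero value of `deriv (deriv φ) 1` entails that `φ`
is differentiable around `1` and twice differentiable at `1`. Values of `φ` on `(-∞, 0]` are never
used.) -/
structure IsDivergenceFunction (φ : ℝ → ℝ) : Prop where
  convexOn : ConvexOn ℝ (Set.Ioi 0) φ
  map_one : φ 1 = 0
  hasDerivAt_one : HasDerivAt φ 0 1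
  second_deriv_pos : 0 < deriv (deriv φ) 1

/-- The extension of a (nonnegative, convex) `φ : (0, ∞) → ℝ` to `[0, ∞)` with values in `[0, ∞]`:
the value at `0` is `lim_{u ↓ 0} φ u`, possibly `∞`. For `φ` in the class above this limit exists,
so that the `limsup` is the limit. -/
def extend (φ : ℝ → ℝ) (x : ℝ) : ℝ≥0∞ :=
  if 0 < x then ENNReal.ofReal (φ x)
  else limsup (fun u : ℝ => ENNReal.ofReal (φ u)) (𝓝[>] 0)

/-- The `φ`-divergence between the probability vectors `(w₁ p₁, w₁ (1 - p₁), …, w_I (1 - p_I))` and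
`(w₁ q₁, w₁ (1 - q₁), …, w_I (1 - q_I))`, where `w_i ≥ 0`, `0 ≤ p_i ≤ 1` and `0 < q_i < 1`. A term
with `w_i = 0` vanishes, as the convention `0 φ(0/0) = 0` requires. -/
def divergence {I : ℕ} (φ : ℝ → ℝ) (w p q : EuclideanSpace ℝ (Fin I)) : ℝ≥0∞ :=
  ∑ i, ENNReal.ofReal (w i) *
    (ENNReal.ofReal (q i) * extend φ (p i / q i) +
      ENNReal.ofReal (1 - q i) * extend φ ((1 - p i) / (1 - q i)))

/-- The design matrix, with rows `(1, x_{i1}, …, x_{ik})`. -/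
def design {I k : ℕ} (x : Matrix (Fin I) (Fin k) ℝ) : Matrix (Fin I) (Fin (k + 1)) ℝ :=
  Matrix.of fun i => Fin.cons 1 (x i)

/-- The vector of logistic probabilities `π(x_iᵀ β) = exp(x_iᵀ β) / (1 + exp(x_iᵀ β))`, where
`x_iᵀ` is the `i`-th row of `X`. -/
def logisticProb {I m : ℕ} (X : Matrix (Fin I) (Fin m) ℝ) (β : EuclideanSpace ℝ (Fin m)) :
    EuclideanSpace ℝ (Fin I) :=
  WithLp.toLp 2 fun i => Real.exp ((X *ᵥ β.ofLp) i) / (1 + Real.exp ((X *ᵥ β.ofLp) i))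

/-- The relative sizes `N_i / N`, `N = ∑ N_j`, of domains of sizes `N_1, …, N_I`. -/
def relativeSize {I : ℕ} (N : Fin I → ℝ) : EuclideanSpace ℝ (Fin I) :=
  WithLp.toLp 2 fun i => N i / ∑ j, N j

/-- The ratio estimates `N_{i1} / N_i`. -/
def ratioEstimate {I : ℕ} (N₁ N : Fin I → ℝ) : EuclideanSpace ℝ (Fin I) :=
  WithLp.toLp 2 fun i => N₁ i / N i

/-- `b` minimizes the `φ`-divergence between the vectors with conditional probabilities `p` and
with logistic probabilities `π(X β)`, with weights `w`, over all parameters `β`. -/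
def IsPseudoMinimizer {I m : ℕ} (φ : ℝ → ℝ) (X : Matrix (Fin I) (Fin m) ℝ)
    (w p : EuclideanSpace ℝ (Fin I)) (b : EuclideanSpace ℝ (Fin m)) : Prop :=
  ∀ β, divergence φ w p (logisticProb X b) ≤ divergence φ w p (logisticProb X β)

/-- `Δ = diag (W_i π_i (1 - π_i))`. -/
def Delta {I : ℕ} (W q : EuclideanSpace ℝ (Fin I)) : Matrix (Fin I) (Fin I) ℝ :=
  Matrix.diagonal fun i => W i * q i * (1 - q i)

/-- `(Xᵀ Δ X)⁻¹ Xᵀ diag(W) V diag(W) X (Xᵀ Δ X)⁻¹`. -/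
def sandwich {I m : ℕ} (X : Matrix (Fin I) (Fin m) ℝ) (W q : EuclideanSpace ℝ (Fin I))
    (V : Matrix (Fin I) (Fin I) ℝ) : Matrix (Fin m) (Fin m) ℝ :=
  (Xᵀ * Delta W q * X)⁻¹ * Xᵀ * Matrix.diagonal W.ofLp * V * Matrix.diagonal W.ofLp * X *
    (Xᵀ * Delta W q * X)⁻¹

end PseudoPhi

end

/-! Write `q` for the true probabilities, `c = φ''(1)` and `d = p - q`. Near `(W, q, β₀)` the
objective equals `c / 2` times a weighted least squares loss in `d` and `h = β - β₀`, up to `o((‖d‖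
+ ‖h‖)²)` (`isLittleO_objective`). The function `φ` enters the main term only through the factor
`c`, which does not move the minimizer, so the limit cannot depend on it. The loss is minimized at
`h = T d` with `T = (Xᵀ Δ X)⁻¹ Xᵀ diag(W)`, and it grows quadratically away from that point.

Away from `β₀` the objective stays above a positive constant, uniformly in nearby data, while at
`β₀` it is small. Hence for data near `(W, q)` minimizers exist and all lie near `β₀`; comparing a
minimizer `b` with the competitor `β₀ + T d` gives `‖b - β₀ - T d‖ ≤ ε ‖d‖`
(`eventually_isPseudoMinimizer`). This is purely deterministic.

Probability enters last: consistency puts the data in that neighbourhood with probability tending to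
one, and a delta method (`tendstoInDistribution_smul_of_linearization`) carries the limit `N(0, V)`
to its image `N(0, T V Tᵀ)`. -/

namespace PseudoPhi

/-! ### Divergence functions: Taylor expansion at 1 and convexity bounds. -/

namespace IsDivergenceFunction

variable {φ : ℝ → ℝ}

/-- The second derivative is only given at 1, so the mean value inequality is applied to `φ u - c /
2 * (u - 1) ^ 2`, whose derivative is `o(u - 1)`. -/
theorem isLittleO_sub_sq (hφ : IsDivergenceFunction φ) :
    (fun u => φ u - deriv (deriv φ) 1 / 2 * (u - 1) ^ 2) =o[𝓝 1] fun u => (u - 1) ^ 2 := by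
  set c := deriv (deriv φ) 1 with hc
  have hcpos : 0 < c := hφ.second_deriv_pos
  have hd : HasDerivAt (deriv φ) c 1 :=
    (differentiableAt_of_deriv_ne_zero hcpos.ne').hasDerivAt
  have hd1 : deriv φ 1 = 0 := hφ.hasDerivAt_one.deriv
  -- `deriv φ` takes the default value 0 where `φ` is not differentiable; since `c ≠ 0`, it is
  -- nonzero at every point near 1 other than 1.
  have hdiff : ∀ᶠ u in 𝓝 (1 : ℝ), DifferentiableAt ℝ φ u := by
    have h1 : ∀ᶠ u in 𝓝[≠] (1 : ℝ), deriv φ u ≠ deriv φ 1 := by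
      simpa using hd.eventually_ne hcpos.ne' (c := deriv φ 1)
    rw [eventually_nhdsWithin_iff] at h1
    filter_upwards [h1] with u hu
    by_cases h : u = 1
    · rw [h]; exact hφ.hasDerivAt_one.differentiableAt
    · exact differentiableAt_of_deriv_ne_zero (hd1 ▸ hu h)
  rw [Asymptotics.isLittleO_iff]
  intro ε hε
  have hlo := (hasDerivAt_iff_isLittleO.1 hd).def hε
  obtain ⟨r, hr, hball⟩ := Metric.eventually_nhds_iff_ball.1 (hlo.and hdiff)
  filter_upwards [Metric.ball_mem_nhds 1 hr] with u hu
  have key := (convex_uIcc (1 : ℝ) u).norm_image_sub_le_of_norm_hasDerivWithin_le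
    (f := fun u => φ u - c / 2 * (u - 1) ^ 2) (f' := fun u => deriv φ u - c * (u - 1))
    (C := ε * |u - 1|) (x := 1) (y := u) ?_ ?_ Set.left_mem_uIcc Set.right_mem_uIcc
  · simp only [hφ.map_one, sub_self] at key
    rw [Real.norm_eq_abs] at key ⊢
    rw [norm_pow, Real.norm_eq_abs]
    calc _ ≤ ε * |u - 1| * |u - 1| := by simpa using key
      _ = _ := by ring
  all_goals
    intro y hy
    have hy1 : |y - 1| ≤ |u - 1| := Set.abs_sub_left_of_mem_uIcc hy
    have hyb : y ∈ Metric.ball (1 : ℝ) r := by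
      rw [Metric.mem_ball, Real.dist_eq] at hu ⊢
      exact hy1.trans_lt hu
  · have h1 := (hball y hyb).2.hasDerivAt
    have h2 : HasDerivAt (fun u : ℝ => c / 2 * (u - 1) ^ 2) (c * (y - 1)) y := by
      convert! (((hasDerivAt_id y).sub_const 1).pow 2).const_mul (c / 2) using 1
      simp; ring
    exact (h1.sub h2).hasDerivWithinAt
  · have h1 := (hball y hyb).1
    rw [hd1, sub_zero, smul_eq_mul, mul_comm (y - 1)] at h1
    exact h1.trans (mul_le_mul_of_nonneg_left hy1 hε.le)

/-- The Taylor expansion makes 1 a local minimum, and convexity makes it global. -/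
theorem nonneg (hφ : IsDivergenceFunction φ) {u : ℝ} (hu : 0 < u) : 0 ≤ φ u := by
  have hlin : ∀ᶠ v in 𝓝 (1 : ℝ), 0 ≤ φ v := by
    have := hφ.isLittleO_sub_sq.def (half_pos hφ.second_deriv_pos)
    filter_upwards [this] with v hv
    rw [Real.norm_eq_abs, norm_pow, Real.norm_eq_abs, sq_abs] at hv
    linarith [(abs_le.1 hv).1]
  have hmin : IsLocalMin φ 1 := by
    filter_upwards [hlin] with v hv
    rwa [hφ.map_one]
  have := IsMinOn.of_isLocalMinOn_of_convexOn (Set.mem_Ioi.2 one_pos)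
    (hmin.on (Set.Ioi 0)) hφ.convexOn
  simpa [hφ.map_one] using this (Set.mem_Ioi.2 hu)

/-- Chord slopes from the point 1 increase, and `φ 1 = 0`. -/
theorem mul_le_mul (hφ : IsDivergenceFunction φ) {s δ : ℝ} (hs : 0 < s) (hsδ : s ≤ δ) :
    δ * φ (1 + s) ≤ s * φ (1 + δ) := by
  have hδ := hs.trans_le hsδ
  have hconv := hφ.convexOn.2
  have := hconv (Set.mem_Ioi.2 one_pos)
    (Set.mem_Ioi.2 (by linarith : (0 : ℝ) < 1 + δ)) (a := 1 - s / δ) (b := s / δ)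
    (by rw [sub_nonneg, div_le_one hδ]; exact hsδ) (by positivity) (by ring)
  have h2 : (1 - s / δ) • (1 : ℝ) + (s / δ) • (1 + δ) = 1 + s := by
    simp only [smul_eq_mul]; field_simp; ring
  rw [h2, hφ.map_one, smul_zero, zero_add, smul_eq_mul] at this
  calc δ * φ (1 + s) ≤ δ * (s / δ * φ (1 + δ)) := by gcongr
    _ = s * φ (1 + δ) := by field_simp

theorem pos_one_add (hφ : IsDivergenceFunction φ) {δ : ℝ} (hδ : 0 < δ) : 0 < φ (1 + δ) := by
  have hc := hφ.second_deriv_pos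
  have h1 := hφ.isLittleO_sub_sq.def (half_pos (half_pos hc))
  have ht : Tendsto (fun s : ℝ => 1 + s) (𝓝[>] 0) (𝓝 1) := by
    have : Tendsto (fun s : ℝ => 1 + s) (𝓝 0) (𝓝 (1 + 0)) := (continuous_const_add 1).tendsto 0
    rw [add_zero] at this
    exact this.mono_left nhdsWithin_le_nhds
  obtain ⟨s, hs, hs0, hsδ⟩ := ((ht.eventually h1).and (Ioc_mem_nhdsGT hδ)).exists
  rw [Real.norm_eq_abs, norm_pow, Real.norm_eq_abs, sq_abs] at hs
  have h2 : 0 < φ (1 + s) := by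
    have := (abs_le.1 hs).1
    have h3 : 0 < deriv (deriv φ) 1 * (1 + s - 1) ^ 2 := by
      have : (1 + s - 1) = s := by ring
      rw [this]; positivity
    linarith
  have := hφ.mul_le_mul hs0 hsδ
  by_contra! hcon
  nlinarith [mul_pos hδ h2]

/-- With `s = p / t - 1 ≥ δ`, slope monotonicity gives `t φ(1 + s) ≥ t s φ(1 + δ) / δ`, and `t s = p
- t ≥ δ`. The bound is thus uniform in `t`, even as `t → 0`. -/
theorem le_mul_div (hφ : IsDivergenceFunction φ) {p t δ : ℝ} (hδ : 0 < δ) (ht : 0 < t)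
    (ht1 : t < 1) (hpt : t + δ ≤ p) : φ (1 + δ) ≤ t * φ (p / t) := by
  have hs : δ ≤ p / t - 1 := by
    rw [le_sub_iff_add_le, le_div_iff₀ ht]
    nlinarith
  have h1 := hφ.mul_le_mul hδ hs
  rw [add_sub_cancel] at h1
  have h2 : δ ≤ t * (p / t - 1) := by
    have : t * (p / t - 1) = p - t := by field_simp
    linarith
  have h3 := hφ.pos_one_add hδ
  have h4 : δ * φ (1 + δ) ≤ δ * (t * φ (p / t)) := by nlinarith
  exact le_of_mul_le_mul_left h4 hδ

end IsDivergenceFunction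

/-! ### The divergence between two Bernoulli laws. -/

/-- The `φ`-divergence between the Bernoulli distributions of parameters `p` and `t`. -/
noncomputable def bernoulliDivergence (φ : ℝ → ℝ) (p t : ℝ) : ℝ :=
  t * φ (p / t) + (1 - t) * φ ((1 - p) / (1 - t))

section bernoulliDivergence

variable {φ : ℝ → ℝ} {p t : ℝ}

theorem bernoulliDivergence_nonneg (hφ : IsDivergenceFunction φ)
    (hp : p ∈ Set.Ioo 0 1) (ht : t ∈ Set.Ioo 0 1) : 0 ≤ bernoulliDivergence φ p t :=
  add_nonneg (mul_nonneg ht.1.le (hφ.nonneg (div_pos hp.1 ht.1)))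
    (mul_nonneg (sub_nonneg.2 ht.2.le) (hφ.nonneg (div_pos (sub_pos.2 hp.2) (sub_pos.2 ht.2))))

/-- Either the success ratio or the failure ratio exceeds 1, so only the behaviour of `φ` to the
right of 1 is needed. -/
theorem le_bernoulliDivergence (hφ : IsDivergenceFunction φ) (hp : p ∈ Set.Ioo 0 1)
    (ht : t ∈ Set.Ioo 0 1) {δ : ℝ} (hδ : 0 < δ) (hpt : δ ≤ |p - t|) :
    φ (1 + δ) ≤ bernoulliDivergence φ p t := by
  have h1 := mul_nonneg ht.1.le (hφ.nonneg (div_pos hp.1 ht.1))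
  have h2 := mul_nonneg (sub_nonneg.2 ht.2.le)
    (hφ.nonneg (div_pos (sub_pos.2 hp.2) (sub_pos.2 ht.2)))
  unfold bernoulliDivergence
  rcases le_abs.1 hpt with h | h
  · have := hφ.le_mul_div hδ ht.1 ht.2 (p := p) (by linarith)
    linarith
  · have := hφ.le_mul_div hδ (t := 1 - t) (by linarith [ht.2]) (by linarith [ht.1]) (p := 1 - p)
      (by linarith)
    linarith

theorem continuousOn_bernoulliDivergence (hφ : IsDivergenceFunction φ) (hp : p ∈ Set.Ioo 0 1) :
    ContinuousOn (bernoulliDivergence φ p) (Set.Ioo 0 1) := by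
  have hcont : ContinuousOn φ (Set.Ioi 0) := hφ.convexOn.continuousOn isOpen_Ioi
  have h0 : ∀ t ∈ Set.Ioo (0 : ℝ) 1, t ≠ 0 := fun t ht => ht.1.ne'
  have h1 : ∀ t ∈ Set.Ioo (0 : ℝ) 1, 1 - t ≠ 0 := fun t ht => (sub_pos.2 ht.2).ne'
  unfold bernoulliDivergence
  refine (continuousOn_id.mul (hcont.comp ?_ ?_)).add ((continuousOn_const.sub continuousOn_id).mul
    (hcont.comp ?_ ?_))
  · exact continuousOn_const.div continuousOn_id h0
  · exact fun t ht => div_pos hp.1 ht.1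
  · exact continuousOn_const.div (continuousOn_const.sub continuousOn_id) h1
  · exact fun t ht => div_pos (sub_pos.2 hp.2) (sub_pos.2 ht.2)

theorem isLittleO_mul_div (hφ : IsDivergenceFunction φ) {q : ℝ} (hq : 0 < q) :
    (fun z : ℝ × ℝ => z.2 * φ (z.1 / z.2) - deriv (deriv φ) 1 / 2 * ((z.1 - z.2) ^ 2 / q))
      =o[𝓝 (q, q)] fun z => (z.1 - z.2) ^ 2 := by
  set c := deriv (deriv φ) 1
  have hdiv : Tendsto (fun z : ℝ × ℝ => z.1 / z.2) (𝓝 (q, q)) (𝓝 1) := by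
    have : ContinuousAt (fun z : ℝ × ℝ => z.1 / z.2) (q, q) :=
      continuousAt_fst.div continuousAt_snd hq.ne'
    simpa [ContinuousAt, div_self hq.ne'] using this
  have hinv : Tendsto (fun z : ℝ × ℝ => z.2⁻¹) (𝓝 (q, q)) (𝓝 q⁻¹) :=
    continuousAt_snd.inv₀ hq.ne'
  have hpos : ∀ᶠ z : ℝ × ℝ in 𝓝 (q, q), 0 < z.2 :=
    continuousAt_snd.eventually (lt_mem_nhds hq)
  have hinvO : (fun z : ℝ × ℝ => z.2⁻¹) =O[𝓝 (q, q)] fun _ => (1 : ℝ) := hinv.isBigO_one ℝ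
  have h1 : (fun z : ℝ × ℝ => z.2 * (φ (z.1 / z.2) - c / 2 * (z.1 / z.2 - 1) ^ 2))
      =o[𝓝 (q, q)] fun z => (z.1 - z.2) ^ 2 := by
    have ha := (Asymptotics.isBigO_refl (fun z : ℝ × ℝ => z.2) (𝓝 (q, q))).mul_isLittleO
      (hφ.isLittleO_sub_sq.comp_tendsto hdiv)
    refine ha.trans_isBigO ?_
    have hb := (Asymptotics.isBigO_refl (fun z : ℝ × ℝ => (z.1 - z.2) ^ 2) (𝓝 (q, q))).mul hinvO
    refine Asymptotics.IsBigO.trans (EventuallyEq.isBigO ?_) (by simpa using hb)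
    filter_upwards [hpos] with z hz
    simp only [Function.comp]
    field_simp
  -- The exact factor is `1 / t`; freezing it at `1 / q` costs only a term of smaller order.
  have h2 : (fun z : ℝ × ℝ => c / 2 * ((z.1 - z.2) ^ 2 * (z.2⁻¹ - q⁻¹)))
      =o[𝓝 (q, q)] fun z => (z.1 - z.2) ^ 2 := by
    refine Asymptotics.IsLittleO.const_mul_left ?_ _
    have ha : (fun z : ℝ × ℝ => z.2⁻¹ - q⁻¹) =o[𝓝 (q, q)] fun _ => (1 : ℝ) :=
      (Asymptotics.isLittleO_one_iff ℝ).2 (by simpa using hinv.sub_const q⁻¹)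
    simpa using (Asymptotics.isBigO_refl (fun z : ℝ × ℝ => (z.1 - z.2) ^ 2)
      (𝓝 (q, q))).mul_isLittleO ha
  refine (h1.add h2).congr' ?_ EventuallyEq.rfl
  filter_upwards [hpos] with z hz
  field_simp
  ring

theorem isLittleO_bernoulliDivergence (hφ : IsDivergenceFunction φ) {q : ℝ}
    (hq : q ∈ Set.Ioo 0 1) :
    (fun z : ℝ × ℝ => bernoulliDivergence φ z.1 z.2 -
        deriv (deriv φ) 1 / 2 * ((z.1 - z.2) ^ 2 / (q * (1 - q))))
      =o[𝓝 (q, q)] fun z => (z.1 - z.2) ^ 2 := by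
  have h1 := isLittleO_mul_div hφ hq.1
  have hq' : 0 < 1 - q := sub_pos.2 hq.2
  have ht : Tendsto (fun z : ℝ × ℝ => (1 - z.1, 1 - z.2)) (𝓝 (q, q)) (𝓝 (1 - q, 1 - q)) :=
    Continuous.tendsto (by fun_prop) (q, q)
  have h2 := ((isLittleO_mul_div hφ hq').comp_tendsto ht).congr
    (g₂ := fun z : ℝ × ℝ => (z.1 - z.2) ^ 2) (fun z => rfl)
    (fun z => by simp only [Function.comp]; ring)
  refine (h1.add h2).congr (fun z => ?_) fun z => rfl
  have := hq.1
  simp only [Function.comp, bernoulliDivergence]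
  field_simp
  ring

end bernoulliDivergence

/-! ### The logistic map and its continuous left inverse. -/

section logistic

variable {I m : ℕ} (X : Matrix (Fin I) (Fin m) ℝ)

theorem logisticProb_apply (β : EuclideanSpace ℝ (Fin m)) (i : Fin I) :
    logisticProb X β i = Real.sigmoid ((X *ᵥ β.ofLp) i) := by
  simp only [logisticProb, Real.sigmoid_def, Real.exp_neg]
  have := Real.exp_pos ((X *ᵥ β.ofLp) i)
  field_simp
  ring

theorem logisticProb_mem_Ioo (β : EuclideanSpace ℝ (Fin m)) (i : Fin I) :
    logisticProb X β i ∈ Set.Ioo 0 1 := by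
  rw [logisticProb_apply]
  exact ⟨Real.sigmoid_pos _, Real.sigmoid_lt_one _⟩

theorem continuous_mulVec_apply (i : Fin I) :
    Continuous fun β : EuclideanSpace ℝ (Fin m) => (X *ᵥ β.ofLp) i := by
  simp only [mulVec, dotProduct]
  fun_prop

theorem continuous_logisticProb_apply (i : Fin I) :
    Continuous fun β => logisticProb X β i := by
  simp only [logisticProb_apply]
  exact continuous_sigmoid.comp (continuous_mulVec_apply X i)

theorem isBigO_mulVec_apply {α : Type*} {l : Filter α} (f : α → EuclideanSpace ℝ (Fin m))
    (i : Fin I) : (fun a => (X *ᵥ (f a).ofLp) i) =O[l] f := by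
  have h := ((EuclideanSpace.proj (𝕜 := ℝ) i).comp
    (toEuclideanLin X).toContinuousLinearMap).isBigO_comp f l
  exact h

theorem isLittleO_logisticProb (β₀ : EuclideanSpace ℝ (Fin m)) (i : Fin I) :
    (fun β => logisticProb X β i - logisticProb X β₀ i -
        logisticProb X β₀ i * (1 - logisticProb X β₀ i) * (X *ᵥ (β - β₀).ofLp) i)
      =o[𝓝 β₀] fun β => β - β₀ := by
  simp only [logisticProb_apply]
  have h := (hasDerivAt_iff_isLittleO.1
    (Real.hasDerivAt_sigmoid ((X *ᵥ β₀.ofLp) i))).comp_tendsto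
      ((continuous_mulVec_apply X i).tendsto β₀)
  have e : ∀ β : EuclideanSpace ℝ (Fin m),
      (X *ᵥ β.ofLp) i - (X *ᵥ β₀.ofLp) i = (X *ᵥ (β - β₀).ofLp) i := fun β => by
    rw [WithLp.ofLp_sub, mulVec_sub, Pi.sub_apply]
  simp only [Function.comp_def, e, smul_eq_mul] at h
  refine (h.trans_isBigO (isBigO_mulVec_apply X _ i)).congr_left fun β => by ring

variable {X}

theorem ker_toEuclideanLin (hX : Function.Injective X.mulVec) :
    LinearMap.ker (toEuclideanLin X) = ⊥ := by
  refine LinearMap.ker_eq_bot.2 fun a b hab => ?_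
  have : X *ᵥ a.ofLp = X *ᵥ b.ofLp := congrArg WithLp.ofLp hab
  exact WithLp.ofLp_injective 2 (hX this)

/-- The logit transform followed by a linear left inverse of `X` inverts `logisticProb X`. -/
theorem exists_leftInverse_logisticProb (hX : Function.Injective X.mulVec)
    (β₀ : EuclideanSpace ℝ (Fin m)) :
    ∃ g : EuclideanSpace ℝ (Fin I) → EuclideanSpace ℝ (Fin m),
      (∀ β, g (logisticProb X β) = β) ∧ ContinuousAt g (logisticProb X β₀) := by
  obtain ⟨L, hL⟩ := LinearMap.exists_leftInverse_of_injective _ (ker_toEuclideanLin hX)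
  refine ⟨fun t => L (WithLp.toLp 2 fun i => Real.log (t i / (1 - t i))), fun β => ?_, ?_⟩
  · have e : (WithLp.toLp 2 fun i => Real.log (logisticProb X β i / (1 - logisticProb X β i)))
        = toEuclideanLin X β := by
      ext i
      have := Real.exp_pos ((X *ᵥ β.ofLp) i)
      have h : logisticProb X β i / (1 - logisticProb X β i) = Real.exp ((X *ᵥ β.ofLp) i) := by
        simp only [logisticProb]
        field_simp
        ring
      simp only [h, Real.log_exp]
      rfl
    simp only [e]
    exact LinearMap.congr_fun hL β
  · refine L.continuous_of_finiteDimensional.continuousAt.comp ?_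
    refine (PiLp.continuous_toLp 2 _).continuousAt.comp (continuousAt_pi.2 fun i => ?_)
    have hq := logisticProb_mem_Ioo X β₀ i
    have hi : ContinuousAt (fun t : EuclideanSpace ℝ (Fin I) => t i) (logisticProb X β₀) :=
      Continuous.continuousAt (by fun_prop)
    exact (hi.div (continuousAt_const.sub hi) (sub_pos.2 hq.2).ne').log
      (div_pos hq.1 (sub_pos.2 hq.2)).ne'

/-- If `logisticProb X β` is close to `logisticProb X β₀`, then `β` is close to `β₀`. -/
theorem exists_separation (hX : Function.Injective X.mulVec) {β₀ : EuclideanSpace ℝ (Fin m)}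
    {U : Set (EuclideanSpace ℝ (Fin m))} (hU : U ∈ 𝓝 β₀) :
    ∃ δ > 0, ∀ β ∉ U, ∃ i, δ ≤ |logisticProb X β i - logisticProb X β₀ i| := by
  obtain ⟨g, hg, hgc⟩ := exists_leftInverse_logisticProb hX β₀
  have hmem : g ⁻¹' U ∈ 𝓝 (logisticProb X β₀) := hgc (by rwa [hg])
  -- Passing to the sup metric: leaving a ball of radius `δ` there means that a single coordinate is
  -- off by at least `δ`.
  obtain ⟨S, hS, hSU⟩ := Filter.mem_comap.1
    ((PiLp.homeomorph 2 fun _ : Fin I => ℝ).nhds_eq_comap (logisticProb X β₀) ▸ hmem)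
  obtain ⟨δ, hδ, hball⟩ := Metric.mem_nhds_iff.1 hS
  refine ⟨δ, hδ, fun β hβ => ?_⟩
  by_contra! hcon
  refine hβ ?_
  rw [← hg β]
  refine hSU (hball ?_)
  rw [Metric.mem_ball, dist_pi_lt_iff hδ]
  exact fun i => hcon i

end logistic

/-! ### The real-valued objective and its lower bound away from the true parameter. -/

section objective

variable {I m : ℕ} {φ : ℝ → ℝ} {X : Matrix (Fin I) (Fin m) ℝ}

/-- The real-valued form of the objective `β ↦ divergence φ w p (logisticProb X β)`. -/
noncomputable def objective (φ : ℝ → ℝ) (X : Matrix (Fin I) (Fin m) ℝ)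
    (w p : EuclideanSpace ℝ (Fin I)) (β : EuclideanSpace ℝ (Fin m)) : ℝ :=
  ∑ i, w i * bernoulliDivergence φ (p i) (logisticProb X β i)

/-- For `p` in the open cube, `φ` is evaluated at positive ratios only, so the possibly infinite
value at 0 never occurs. -/
theorem divergence_eq_ofReal (hφ : IsDivergenceFunction φ) {w p : EuclideanSpace ℝ (Fin I)}
    (hw : ∀ i, 0 ≤ w i) (hp : ∀ i, p i ∈ Set.Ioo 0 1) (β : EuclideanSpace ℝ (Fin m)) :
    divergence φ w p (logisticProb X β) = ENNReal.ofReal (objective φ X w p β) := by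
  have ht := logisticProb_mem_Ioo X β
  rw [objective, ENNReal.ofReal_sum_of_nonneg fun i _ =>
    mul_nonneg (hw i) (bernoulliDivergence_nonneg hφ (hp i) (ht i))]
  refine Finset.sum_congr rfl fun i _ => ?_
  have h1 := div_pos (hp i).1 (ht i).1
  have h2 := div_pos (sub_pos.2 (hp i).2) (sub_pos.2 (ht i).2)
  rw [ENNReal.ofReal_mul (hw i), bernoulliDivergence, extend, extend, if_pos h1, if_pos h2,
    ENNReal.ofReal_add (mul_nonneg (ht i).1.le (hφ.nonneg h1))
      (mul_nonneg (sub_pos.2 (ht i).2).le (hφ.nonneg h2)),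
    ENNReal.ofReal_mul (ht i).1.le, ENNReal.ofReal_mul (sub_pos.2 (ht i).2).le]

theorem objective_nonneg (hφ : IsDivergenceFunction φ) {w p : EuclideanSpace ℝ (Fin I)}
    (hw : ∀ i, 0 ≤ w i) (hp : ∀ i, p i ∈ Set.Ioo 0 1) (β : EuclideanSpace ℝ (Fin m)) :
    0 ≤ objective φ X w p β :=
  Finset.sum_nonneg fun i _ => mul_nonneg (hw i)
    (bernoulliDivergence_nonneg hφ (hp i) (logisticProb_mem_Ioo X β i))

theorem isPseudoMinimizer_iff (hφ : IsDivergenceFunction φ) {w p : EuclideanSpace ℝ (Fin I)}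
    (hw : ∀ i, 0 ≤ w i) (hp : ∀ i, p i ∈ Set.Ioo 0 1) (b : EuclideanSpace ℝ (Fin m)) :
    IsPseudoMinimizer φ X w p b ↔ ∀ β, objective φ X w p b ≤ objective φ X w p β := by
  simp only [IsPseudoMinimizer, divergence_eq_ofReal hφ hw hp,
    ENNReal.ofReal_le_ofReal_iff (objective_nonneg hφ hw hp _)]

theorem continuous_objective (hφ : IsDivergenceFunction φ) {w p : EuclideanSpace ℝ (Fin I)}
    (hp : ∀ i, p i ∈ Set.Ioo 0 1) : Continuous (objective φ X w p) :=
  continuous_finsetSum _ fun i _ => continuous_const.mul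
    ((continuousOn_bernoulliDivergence hφ (hp i)).comp_continuous
      (continuous_logisticProb_apply X i) fun β => logisticProb_mem_Ioo X β i)

theorem eventually_forall_mem_Ioo {q : EuclideanSpace ℝ (Fin I)} (hq : ∀ i, q i ∈ Set.Ioo 0 1)
    (W : EuclideanSpace ℝ (Fin I)) :
    ∀ᶠ z : EuclideanSpace ℝ (Fin I) × EuclideanSpace ℝ (Fin I) in 𝓝 (W, q),
      ∀ i, z.2 i ∈ Set.Ioo (0 : ℝ) 1 :=
  eventually_all.2 fun i =>
    (Continuous.tendsto (by fun_prop : Continuous fun z : EuclideanSpace ℝ (Fin I) ×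
      EuclideanSpace ℝ (Fin I) => z.2 i) (W, q)).eventually (Ioo_mem_nhds (hq i).1 (hq i).2)

theorem exists_pos_forall_le {ι : Type*} [Finite ι] {a : ι → ℝ} (ha : ∀ i, 0 < a i) :
    ∃ μ > 0, ∀ i, μ ≤ a i := by
  have h : ∀ᶠ μ in 𝓝[>] (0 : ℝ), ∀ i, μ ∈ Set.Ioc 0 (a i) :=
    eventually_all.2 fun i => Ioc_mem_nhdsGT (ha i)
  obtain ⟨μ, hμ, hμ0⟩ := (h.and self_mem_nhdsWithin).exists
  exact ⟨μ, hμ0, fun i => (hμ i).2⟩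

/-- Outside a neighbourhood of the true parameter, the objective is bounded away from `0`, uniformly
in the data. -/
theorem exists_forall_notMem_le_objective (hφ : IsDivergenceFunction φ)
    (hX : Function.Injective X.mulVec) {W : EuclideanSpace ℝ (Fin I)} (hW : ∀ i, 0 < W i)
    {β₀ : EuclideanSpace ℝ (Fin m)} {U : Set (EuclideanSpace ℝ (Fin m))} (hU : U ∈ 𝓝 β₀) :
    ∃ η > 0, ∀ᶠ z : EuclideanSpace ℝ (Fin I) × EuclideanSpace ℝ (Fin I) in
      𝓝 (W, logisticProb X β₀), ∀ β ∉ U, η ≤ objective φ X z.1 z.2 β := by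
  obtain ⟨δ, hδ, hsep⟩ := exists_separation hX hU
  obtain ⟨μ, hμ, hμW⟩ := exists_pos_forall_le hW
  have hδ2 := half_pos hδ
  have hφδ := hφ.pos_one_add hδ2
  -- One coordinate is separated by `δ`, of which `p` may use up half; its weight is still at least
  -- `μ / 2`.
  refine ⟨μ / 2 * φ (1 + δ / 2), by positivity, ?_⟩
  have hw : ∀ᶠ z : EuclideanSpace ℝ (Fin I) × EuclideanSpace ℝ (Fin I) in
      𝓝 (W, logisticProb X β₀), ∀ i, μ / 2 < z.1 i :=
    eventually_all.2 fun i =>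
      (Continuous.tendsto (by fun_prop : Continuous fun z : EuclideanSpace ℝ (Fin I) ×
        EuclideanSpace ℝ (Fin I) => z.1 i) _).eventually
        (lt_mem_nhds (by linarith [hμW i] : μ / 2 < W i))
  have hpq : ∀ᶠ z : EuclideanSpace ℝ (Fin I) × EuclideanSpace ℝ (Fin I) in
      𝓝 (W, logisticProb X β₀), ∀ i, |z.2 i - logisticProb X β₀ i| < δ / 2 :=
    eventually_all.2 fun i =>
      (Continuous.tendsto (by fun_prop : Continuous fun z : EuclideanSpace ℝ (Fin I) ×
        EuclideanSpace ℝ (Fin I) => z.2 i) (W, logisticProb X β₀)).eventually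
        (Metric.ball_mem_nhds _ hδ2)
  filter_upwards [hw, hpq, eventually_forall_mem_Ioo (logisticProb_mem_Ioo X β₀) W]
    with z hz1 hz2 hz3 β hβ
  obtain ⟨i, hi⟩ := hsep β hβ
  have hz0 : ∀ j, 0 ≤ z.1 j := fun j => ((half_pos hμ).trans (hz1 j)).le
  have hdist : δ / 2 ≤ |z.2 i - logisticProb X β i| := by
    have := abs_sub_le (logisticProb X β i) (z.2 i) (logisticProb X β₀ i)
    rw [abs_sub_comm (logisticProb X β i) (z.2 i)] at this
    linarith [hz2 i]
  have h1 := le_bernoulliDivergence hφ (hz3 i) (logisticProb_mem_Ioo X β i) hδ2 hdist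
  calc μ / 2 * φ (1 + δ / 2)
      ≤ z.1 i * bernoulliDivergence φ (z.2 i) (logisticProb X β i) :=
        mul_le_mul (hz1 i).le h1 hφδ.le (hz0 i)
    _ ≤ _ := Finset.single_le_sum (f := fun i =>
        z.1 i * bernoulliDivergence φ (z.2 i) (logisticProb X β i)) (fun j _ => mul_nonneg (hz0 j)
          (bernoulliDivergence_nonneg hφ (hz3 j) (logisticProb_mem_Ioo X β j))) (Finset.mem_univ i)

end objective

/-! ### Least squares approximation and deterministic linearization. -/

section expansion

variable {I m : ℕ} {φ : ℝ → ℝ} {X : Matrix (Fin I) (Fin m) ℝ}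

/-- The weighted least squares loss that approximates the objective near the true parameter. -/
noncomputable def quadraticLoss (X : Matrix (Fin I) (Fin m) ℝ) (W q d : EuclideanSpace ℝ (Fin I))
    (h : EuclideanSpace ℝ (Fin m)) : ℝ :=
  ∑ i, W i / (q i * (1 - q i)) * (d i - q i * (1 - q i) * (X *ᵥ h.ofLp) i) ^ 2

/-- The matrix `(Xᵀ Δ X)⁻¹ Xᵀ diag(W)` of the linear map that minimizes `quadraticLoss`. -/
noncomputable def responseMatrix (X : Matrix (Fin I) (Fin m) ℝ) (W q : EuclideanSpace ℝ (Fin I)) :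
    Matrix (Fin m) (Fin I) ℝ :=
  (Xᵀ * Delta W q * X)⁻¹ * Xᵀ * Matrix.diagonal W.ofLp

theorem isUnit_det_information (hX : Function.Injective X.mulVec)
    {W q : EuclideanSpace ℝ (Fin I)} (hW : ∀ i, 0 < W i) (hq : ∀ i, q i ∈ Set.Ioo 0 1) :
    IsUnit (Xᵀ * Delta W q * X).det := by
  have hΔ : (Delta W q).PosDef := Matrix.PosDef.diagonal fun i =>
    mul_pos (mul_pos (hW i) (hq i).1) (sub_pos.2 (hq i).2)
  have := (hΔ.conjTranspose_mul_mul_same hX).isUnit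
  rw [conjTranspose_eq_transpose_of_trivial] at this
  exact (Matrix.isUnit_iff_isUnit_det _).1 this

theorem sandwich_eq (X : Matrix (Fin I) (Fin m) ℝ) (W q : EuclideanSpace ℝ (Fin I))
    (V : Matrix (Fin I) (Fin I) ℝ) :
    sandwich X W q V = responseMatrix X W q * V * (responseMatrix X W q)ᵀ := by
  have hsymm : (Delta W q)ᵀ = Delta W q := diagonal_transpose _
  simp only [sandwich, responseMatrix, transpose_mul, diagonal_transpose, transpose_transpose,
    transpose_nonsing_inv, hsymm, Matrix.mul_assoc]

/-- The normal equations of the least squares problem. -/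
theorem transpose_mulVec_residual (hX : Function.Injective X.mulVec)
    {W q : EuclideanSpace ℝ (Fin I)} (hW : ∀ i, 0 < W i) (hq : ∀ i, q i ∈ Set.Ioo 0 1)
    (d : Fin I → ℝ) :
    Xᵀ *ᵥ (fun i => W i * (d i - q i * (1 - q i) * (X *ᵥ (responseMatrix X W q *ᵥ d)) i)) = 0 := by
  have e : (fun i => W i * (d i - q i * (1 - q i) * (X *ᵥ (responseMatrix X W q *ᵥ d)) i)) =
      Matrix.diagonal W.ofLp *ᵥ d - Delta W q *ᵥ (X *ᵥ (responseMatrix X W q *ᵥ d)) := by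
    ext i
    simp only [Delta, Pi.sub_apply, mulVec_diagonal]
    ring
  have hdet := isUnit_det_information hX hW hq
  rw [e, mulVec_sub]
  simp only [mulVec_mulVec, responseMatrix]
  have : Xᵀ * (Delta W q * (X * ((Xᵀ * Delta W q * X)⁻¹ * Xᵀ * diagonal W.ofLp))) =
      (Xᵀ * Delta W q * X) * (Xᵀ * Delta W q * X)⁻¹ * (Xᵀ * diagonal W.ofLp) := by
    simp only [Matrix.mul_assoc]
  rw [this, Matrix.mul_nonsing_inv _ hdet, Matrix.one_mul, sub_self]

/-- Pythagoras: the cross term vanishes by the normal equations. -/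
theorem quadraticLoss_eq (hX : Function.Injective X.mulVec)
    {W q : EuclideanSpace ℝ (Fin I)} (hW : ∀ i, 0 < W i) (hq : ∀ i, q i ∈ Set.Ioo 0 1)
    (d : EuclideanSpace ℝ (Fin I)) (h : EuclideanSpace ℝ (Fin m)) :
    quadraticLoss X W q d h =
      quadraticLoss X W q d (toEuclideanLin (responseMatrix X W q) d) +
        ∑ i, W i * (q i * (1 - q i)) *
          ((X *ᵥ (h - toEuclideanLin (responseMatrix X W q) d).ofLp) i) ^ 2 := by
  set a := toEuclideanLin (responseMatrix X W q) d with ha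
  have hn := congrArg (fun v => (h - a).ofLp ⬝ᵥ v) (transpose_mulVec_residual hX hW hq d.ofLp)
  simp only [dotProduct_zero, dotProduct_mulVec, vecMul_transpose] at hn
  have hae : responseMatrix X W q *ᵥ d.ofLp = a.ofLp := rfl
  rw [hae, dotProduct] at hn
  -- The difference of the two sides is exactly `-2` times the cross term.
  have h2 := mul_eq_zero_of_right (-2 : ℝ) hn
  rw [Finset.mul_sum] at h2
  refine eq_of_sub_eq_zero (Eq.trans ?_ h2)
  rw [quadraticLoss, quadraticLoss, ← Finset.sum_add_distrib, ← Finset.sum_sub_distrib]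
  refine Finset.sum_congr rfl fun i _ => ?_
  have e : (X *ᵥ (h - a).ofLp) i = (X *ᵥ h.ofLp) i - (X *ᵥ a.ofLp) i := by
    rw [WithLp.ofLp_sub, mulVec_sub, Pi.sub_apply]
  have h0 := (hq i).1.ne'
  have h1 := (sub_pos.2 (hq i).2).ne'
  rw [e]
  field_simp
  ring

/-- Quadratic growth of the loss around its minimizer: an injective linear map in finite dimension
is bounded below. -/
theorem exists_pos_mul_norm_sq_le (hX : Function.Injective X.mulVec) {a : Fin I → ℝ}
    (ha : ∀ i, 0 < a i) :
    ∃ c > 0, ∀ u : EuclideanSpace ℝ (Fin m), c * ‖u‖ ^ 2 ≤ ∑ i, a i * ((X *ᵥ u.ofLp) i) ^ 2 := by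
  obtain ⟨K, hK, hanti⟩ := LinearMap.exists_antilipschitzWith _ (ker_toEuclideanLin hX)
  obtain ⟨μ, hμ, hle⟩ := exists_pos_forall_le ha
  have hK' : (0 : ℝ) < K := hK
  refine ⟨μ / K ^ 2, by positivity, fun u => ?_⟩
  have h1 : ‖u‖ ≤ K * ‖toEuclideanLin X u‖ := by
    simpa using hanti.le_mul_dist u 0
  have h2 : ‖u‖ ^ 2 ≤ K ^ 2 * ‖toEuclideanLin X u‖ ^ 2 := by
    rw [← mul_pow]; gcongr
  have h3 : ‖toEuclideanLin X u‖ ^ 2 = ∑ i, ((X *ᵥ u.ofLp) i) ^ 2 := by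
    rw [EuclideanSpace.norm_sq_eq]
    simp [toLpLin_apply]
  calc μ / K ^ 2 * ‖u‖ ^ 2 ≤ μ / K ^ 2 * (K ^ 2 * ‖toEuclideanLin X u‖ ^ 2) := by gcongr
    _ = ∑ i, μ * ((X *ᵥ u.ofLp) i) ^ 2 := by rw [h3, ← Finset.mul_sum]; field_simp
    _ ≤ _ := Finset.sum_le_sum fun i _ => mul_le_mul_of_nonneg_right (hle i) (sq_nonneg _)

/-- Second order expansion of the objective at the true parameter, jointly in the data and the
parameter. -/
theorem isLittleO_objective (hφ : IsDivergenceFunction φ) (X : Matrix (Fin I) (Fin m) ℝ)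
    (W : EuclideanSpace ℝ (Fin I)) (β₀ : EuclideanSpace ℝ (Fin m)) :
    (fun z : (EuclideanSpace ℝ (Fin I) × EuclideanSpace ℝ (Fin I)) × EuclideanSpace ℝ (Fin m) =>
      objective φ X z.1.1 z.1.2 z.2 - deriv (deriv φ) 1 / 2 *
        quadraticLoss X W (logisticProb X β₀) (z.1.2 - logisticProb X β₀) (z.2 - β₀))
      =o[𝓝 ((W, logisticProb X β₀), β₀)]
        fun z => (‖z.1.2 - logisticProb X β₀‖ + ‖z.2 - β₀‖) ^ 2 := by
  set q := logisticProb X β₀ with hqdef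
  set c := deriv (deriv φ) 1
  set l := 𝓝 ((W, q), β₀)
  set G : (EuclideanSpace ℝ (Fin I) × EuclideanSpace ℝ (Fin I)) × EuclideanSpace ℝ (Fin m) → ℝ :=
    fun z => ‖z.1.2 - q‖ + ‖z.2 - β₀‖ with hG
  have hβ : Tendsto (fun z : (EuclideanSpace ℝ (Fin I) × EuclideanSpace ℝ (Fin I)) ×
      EuclideanSpace ℝ (Fin m) => z.2) l (𝓝 β₀) := continuousAt_snd
  have hGβ : (fun z : (EuclideanSpace ℝ (Fin I) × EuclideanSpace ℝ (Fin I)) ×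
      EuclideanSpace ℝ (Fin m) => z.2 - β₀) =O[l] G := by
    refine Asymptotics.IsBigO.of_bound 1 (Eventually.of_forall fun z => ?_)
    rw [one_mul, Real.norm_eq_abs]
    exact le_trans (by rw [hG]; linarith [norm_nonneg (z.1.2 - q)]) (le_abs_self _)
  simp only [objective, quadraticLoss, Finset.mul_sum, ← Finset.sum_sub_distrib]
  refine Asymptotics.IsLittleO.fun_sum fun i _ => ?_
  have hq : q i ∈ Set.Ioo 0 1 := logisticProb_mem_Ioo X β₀ i
  set v := q i * (1 - q i) with hv
  have hGp : (fun z : (EuclideanSpace ℝ (Fin I) × EuclideanSpace ℝ (Fin I)) ×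
      EuclideanSpace ℝ (Fin m) => (z.1.2 - q) i) =O[l] G := by
    refine Asymptotics.IsBigO.of_bound 1 (Eventually.of_forall fun z => ?_)
    rw [one_mul, Real.norm_eq_abs (G z)]
    have h1 : ‖(z.1.2 - q) i‖ ≤ ‖z.1.2 - q‖ := PiLp.norm_apply_le (z.1.2 - q) i
    exact le_trans (by rw [hG]; linarith [norm_nonneg (z.2 - β₀)]) (le_abs_self _)
  have hXh : (fun z : (EuclideanSpace ℝ (Fin I) × EuclideanSpace ℝ (Fin I)) ×
      EuclideanSpace ℝ (Fin m) => v * (X *ᵥ (z.2 - β₀).ofLp) i) =O[l] G :=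
    ((isBigO_mulVec_apply X _ i).trans hGβ).const_mul_left v
  have hlin := hGp.sub hXh
  have hrem : (fun z : (EuclideanSpace ℝ (Fin I) × EuclideanSpace ℝ (Fin I)) ×
      EuclideanSpace ℝ (Fin m) => logisticProb X z.2 i - q i -
        v * (X *ᵥ (z.2 - β₀).ofLp) i) =o[l] G :=
    ((isLittleO_logisticProb X β₀ i).comp_tendsto hβ).trans_isBigO hGβ
  have hdiff : (fun z : (EuclideanSpace ℝ (Fin I) × EuclideanSpace ℝ (Fin I)) ×
      EuclideanSpace ℝ (Fin m) => z.1.2 i - logisticProb X z.2 i) =O[l] G :=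
    (hlin.sub hrem.isBigO).congr_left fun z => by
      simp only [PiLp.sub_apply]; ring
  -- Difference of squares: one factor is the remainder of the logistic map, which is `o(G)`, and
  -- the other is `O(G)`.
  have hsq : (fun z : (EuclideanSpace ℝ (Fin I) × EuclideanSpace ℝ (Fin I)) ×
      EuclideanSpace ℝ (Fin m) => (z.1.2 i - logisticProb X z.2 i) ^ 2 -
        ((z.1.2 - q) i - v * (X *ᵥ (z.2 - β₀).ofLp) i) ^ 2) =o[l] fun z => G z ^ 2 :=
    (hrem.neg_left.mul_isBigO (hdiff.add hlin)).congr
      (fun z => by simp only [PiLp.sub_apply]; ring) fun z => by ring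
  have hpt : Tendsto (fun z : (EuclideanSpace ℝ (Fin I) × EuclideanSpace ℝ (Fin I)) ×
      EuclideanSpace ℝ (Fin m) => (z.1.2 i, logisticProb X z.2 i)) l (𝓝 (q i, q i)) := by
    have hc := continuous_logisticProb_apply X i
    have hi : Continuous fun z : (EuclideanSpace ℝ (Fin I) × EuclideanSpace ℝ (Fin I)) ×
      EuclideanSpace ℝ (Fin m) => z.1.2 i := by fun_prop
    exact (hi.prodMk (hc.comp continuous_snd)).tendsto ((W, q), β₀)
  have hdiff2 : (fun z : (EuclideanSpace ℝ (Fin I) × EuclideanSpace ℝ (Fin I)) ×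
      EuclideanSpace ℝ (Fin m) => (z.1.2 i - logisticProb X z.2 i) ^ 2) =O[l]
        fun z => G z ^ 2 := hdiff.pow 2
  have hH := ((isLittleO_bernoulliDivergence hφ hq).comp_tendsto hpt).trans_isBigO hdiff2
  have hHO : (fun z : (EuclideanSpace ℝ (Fin I) × EuclideanSpace ℝ (Fin I)) ×
      EuclideanSpace ℝ (Fin m) => bernoulliDivergence φ (z.1.2 i) (logisticProb X z.2 i)) =O[l]
        fun z => G z ^ 2 :=
    (hH.isBigO.add (hdiff2.const_mul_left (c / 2 / v))).congr_left fun z => by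
      simp only [Function.comp_apply]; ring
  -- The weights need no rate of convergence: `w i - W i` multiplies a divergence that is already
  -- `O(G²)`.
  have hw : (fun z : (EuclideanSpace ℝ (Fin I) × EuclideanSpace ℝ (Fin I)) ×
      EuclideanSpace ℝ (Fin m) => z.1.1 i - W i) =o[l] fun _ => (1 : ℝ) := by
    refine (Asymptotics.isLittleO_one_iff ℝ).2 ?_
    have := Continuous.tendsto (by fun_prop : Continuous fun z : (EuclideanSpace ℝ (Fin I) ×
      EuclideanSpace ℝ (Fin I)) × EuclideanSpace ℝ (Fin m) => z.1.1 i - W i) ((W, q), β₀)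
    simpa using this
  have hwH := (hw.mul_isBigO hHO).congr_right fun z => one_mul _
  refine ((hwH.add (hH.const_mul_left (W i))).add
    (hsq.const_mul_left (W i * (c / 2) / v))).congr_left fun z => ?_
  simp only [Function.comp_apply]
  ring

/-- Deterministic linearization: for data near the true parameters a minimizer exists, and every
minimizer is, to first order, the least squares solution. -/
theorem eventually_isPseudoMinimizer (hφ : IsDivergenceFunction φ)
    (hX : Function.Injective X.mulVec) {W : EuclideanSpace ℝ (Fin I)} (hW : ∀ i, 0 < W i)
    (β₀ : EuclideanSpace ℝ (Fin m)) {ε : ℝ} (hε : 0 < ε) :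
    ∀ᶠ z : EuclideanSpace ℝ (Fin I) × EuclideanSpace ℝ (Fin I) in 𝓝 (W, logisticProb X β₀),
      (∃ b, IsPseudoMinimizer φ X z.1 z.2 b) ∧ ∀ b, IsPseudoMinimizer φ X z.1 z.2 b →
        ‖b - β₀ - toEuclideanLin (responseMatrix X W (logisticProb X β₀))
          (z.2 - logisticProb X β₀)‖ ≤ ε * ‖z.2 - logisticProb X β₀‖ := by
  set q := logisticProb X β₀ with hqdef
  have hq : ∀ i, q i ∈ Set.Ioo 0 1 := logisticProb_mem_Ioo X β₀
  set T := (toEuclideanLin (responseMatrix X W q)).toContinuousLinearMap with hT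
  set c := deriv (deriv φ) 1
  have hc : 0 < c := hφ.second_deriv_pos
  obtain ⟨κ, hκ, hconv⟩ := exists_pos_mul_norm_sq_le hX (a := fun i => W i * (q i * (1 - q i)))
    fun i => mul_pos (hW i) (mul_pos (hq i).1 (sub_pos.2 (hq i).2))
  set B := 1 + ‖T‖ with hB
  have hBpos : 0 < B := by positivity
  -- The first condition absorbs the `2 ρ y²` of the final estimate into half of the growth term.
  -- The second controls the `3 ρ B² ‖d‖²` that remain, two from the minimizer and one from the
  -- competitor.
  obtain ⟨ρ, hρ, hρ1, hρ2⟩ : ∃ ρ > 0, 2 * ρ ≤ c / 2 * κ / 2 ∧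
      3 * ρ * B ^ 2 ≤ c / 2 * κ / 2 * ε ^ 2 := by
    refine ⟨min (c / 2 * κ / 4) (c / 2 * κ / 2 * ε ^ 2 / (3 * B ^ 2)), by positivity, ?_, ?_⟩
    · linarith [min_le_left (c / 2 * κ / 4) (c / 2 * κ / 2 * ε ^ 2 / (3 * B ^ 2))]
    · have := min_le_right (c / 2 * κ / 4) (c / 2 * κ / 2 * ε ^ 2 / (3 * B ^ 2))
      rw [le_div_iff₀ (by positivity)] at this
      linarith
  -- A product neighbourhood makes the expansion uniform over `β ∈ U` for each fixed `z ∈ S`.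
  obtain ⟨S, hS, U, hU, hSU⟩ := Filter.mem_prod_iff.1
    (nhds_prod_eq (X := EuclideanSpace ℝ (Fin I) × EuclideanSpace ℝ (Fin I)) (x := (W, q))
      (y := β₀) ▸ (isLittleO_objective hφ X W β₀).def hρ)
  obtain ⟨r, hr, hrU⟩ := Metric.nhds_basis_closedBall.mem_iff.1 hU
  obtain ⟨η, hη, hout⟩ := exists_forall_notMem_le_objective hφ hX hW
    (Metric.closedBall_mem_nhds β₀ hr)
  have hw0 : ∀ᶠ z : EuclideanSpace ℝ (Fin I) × EuclideanSpace ℝ (Fin I) in 𝓝 (W, q),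
      ∀ i, 0 ≤ z.1 i := eventually_all.2 fun i =>
    ((Continuous.tendsto (by fun_prop : Continuous fun z : EuclideanSpace ℝ (Fin I) ×
      EuclideanSpace ℝ (Fin I) => z.1 i) (W, q)).eventually (lt_mem_nhds (hW i))).mono
        fun _ h => h.le
  have hTd : ∀ᶠ z : EuclideanSpace ℝ (Fin I) × EuclideanSpace ℝ (Fin I) in 𝓝 (W, q),
      β₀ + T (z.2 - q) ∈ U := by
    have := Continuous.tendsto (by fun_prop : Continuous fun z : EuclideanSpace ℝ (Fin I) ×
      EuclideanSpace ℝ (Fin I) => β₀ + T (z.2 - q)) (W, q)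
    simp only [sub_self, map_zero, add_zero] at this
    exact this hU
  have hsmall : ∀ᶠ z : EuclideanSpace ℝ (Fin I) × EuclideanSpace ℝ (Fin I) in 𝓝 (W, q),
      objective φ X z.1 z.2 β₀ < η := by
    have hO : Tendsto (fun z : EuclideanSpace ℝ (Fin I) × EuclideanSpace ℝ (Fin I) =>
        c / 2 * quadraticLoss X W q (z.2 - q) (β₀ - β₀) + ρ * (‖z.2 - q‖ + ‖β₀ - β₀‖) ^ 2)
        (𝓝 (W, q)) (𝓝 0) := by
      have := Continuous.tendsto (by unfold quadraticLoss; fun_prop :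
        Continuous fun z : EuclideanSpace ℝ (Fin I) × EuclideanSpace ℝ (Fin I) =>
        c / 2 * quadraticLoss X W q (z.2 - q) (β₀ - β₀) + ρ * (‖z.2 - q‖ + ‖β₀ - β₀‖) ^ 2) (W, q)
      simpa [quadraticLoss] using this
    filter_upwards [hO.eventually (gt_mem_nhds hη), hS] with z hz hzS
    have h1 : ‖_‖ ≤ ρ * ‖_‖ := hSU (Set.mk_mem_prod hzS (mem_of_mem_nhds hU))
    rw [Real.norm_eq_abs, norm_pow, Real.norm_eq_abs, sq_abs] at h1
    have h2 := (abs_le.1 h1).2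
    simp only at h2
    linarith
  filter_upwards [hS, hout, hw0, hTd, hsmall, eventually_forall_mem_Ioo hq W]
    with z hzS hzout hzw hzT hzη hzp
  simp only [isPseudoMinimizer_iff hφ hzw hzp]
  constructor
  · obtain ⟨b, hb, hmin⟩ := (isCompact_closedBall β₀ r).exists_isMinOn
      ⟨β₀, Metric.mem_closedBall_self hr.le⟩
      (continuous_objective (X := X) (w := z.1) hφ hzp).continuousOn
    refine ⟨b, fun β => ?_⟩
    by_cases hβ : β ∈ Metric.closedBall β₀ r
    · exact hmin hβ
    · exact (hmin (Metric.mem_closedBall_self hr.le)).trans (hzη.le.trans (hzout β hβ))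
  · intro b hb
    have hbU : b ∈ U := by
      by_contra hcon
      exact absurd (hzout b fun h => hcon (hrU h)) (not_le.2 ((hb β₀).trans_lt hzη))
    have h1 : ‖_‖ ≤ ρ * ‖_‖ := hSU (Set.mk_mem_prod hzS hbU)
    have h2 : ‖_‖ ≤ ρ * ‖_‖ := hSU (Set.mk_mem_prod hzS hzT)
    rw [Real.norm_eq_abs, norm_pow, Real.norm_eq_abs, sq_abs] at h1 h2
    have h1' := (abs_le.1 h1).1
    have h2' := (abs_le.1 h2).2
    simp only [add_sub_cancel_left] at h1' h2'
    -- The minimizer is compared with the least squares solution: the expansion is used from below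
    -- at `b` and from above at `β₀ + T d`.
    have hmin := hb (β₀ + T (z.2 - q))
    rw [quadraticLoss_eq hX hW hq (z.2 - q) (b - β₀)] at h1'
    have hc1 := hconv (b - β₀ - T (z.2 - q))
    set d := z.2 - q
    change ‖b - β₀ - T d‖ ≤ ε * ‖d‖
    change _ ≤ _ - c / 2 * (quadraticLoss X W q d (T d) + ∑ i, W i * (q i * (1 - q i)) *
      ((X *ᵥ (b - β₀ - T d).ofLp) i) ^ 2) at h1'
    set y := ‖b - β₀ - T d‖ with hy
    have hTn : ‖T d‖ ≤ ‖T‖ * ‖d‖ := T.le_opNorm d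
    have hbn : ‖b - β₀‖ ≤ y + ‖T d‖ := by
      have := norm_add_le (b - β₀ - T d) (T d)
      rwa [sub_add_cancel] at this
    have hs1 : (‖d‖ + ‖b - β₀‖) ^ 2 ≤ (y + B * ‖d‖) ^ 2 :=
      pow_le_pow_left₀ (by positivity) (by rw [hB]; linarith) 2
    have hs2 : (‖d‖ + ‖T d‖) ^ 2 ≤ (B * ‖d‖) ^ 2 :=
      pow_le_pow_left₀ (by positivity) (by rw [hB]; linarith) 2
    have hmain : c / 2 * κ * y ^ 2 ≤ ρ * (y + B * ‖d‖) ^ 2 + ρ * (B * ‖d‖) ^ 2 := by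
      have e1 := mul_le_mul_of_nonneg_left hs1 hρ.le
      have e2 := mul_le_mul_of_nonneg_left hs2 hρ.le
      have e3 := mul_le_mul_of_nonneg_left hc1 (half_pos hc).le
      rw [mul_assoc]
      linarith
    have hyd : (y + B * ‖d‖) ^ 2 ≤ 2 * y ^ 2 + 2 * (B * ‖d‖) ^ 2 := by
      nlinarith [sq_nonneg (y - B * ‖d‖)]
    have e4 := mul_le_mul_of_nonneg_left hyd hρ.le
    have e5 := mul_le_mul_of_nonneg_right hρ1 (sq_nonneg y)
    have e6 := mul_le_mul_of_nonneg_right hρ2 (sq_nonneg ‖d‖)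
    have hfin : c / 2 * κ / 2 * y ^ 2 ≤ c / 2 * κ / 2 * (ε * ‖d‖) ^ 2 := by
      rw [mul_pow] at hmain e4 ⊢
      linarith
    exact (sq_le_sq₀ (norm_nonneg _) (by positivity)).1 (le_of_mul_le_mul_left hfin (by positivity))

end expansion

/-! ### Gaussian images and the delta method. -/

/-- Characteristic functions are compared, which also covers singular `V`. -/
theorem map_toEuclideanLin_multivariateGaussian {ι κ : Type*} [Fintype ι] [DecidableEq ι]
    [Fintype κ] [DecidableEq κ] (M : Matrix κ ι ℝ) {V : Matrix ι ι ℝ} (hV : V.PosSemidef) :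
    (multivariateGaussian 0 V).map (toEuclideanLin M) =
      multivariateGaussian 0 (M * V * Mᵀ) := by
  have hMV : (M * V * Mᵀ).PosSemidef := by
    simpa using hV.mul_mul_conjTranspose_same M
  refine Measure.ext_of_charFun (E := EuclideanSpace ℝ κ) (funext fun t => ?_)
  have hadj : ∀ y : EuclideanSpace ℝ ι,
      inner ℝ (toEuclideanLin M y) t = inner ℝ y (toEuclideanLin Mᵀ t) := fun y => by
    simp only [toLpLin_apply, EuclideanSpace.inner_eq_star_dotProduct, star_trivial]
    rw [dotProduct_mulVec, mulVec_transpose]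
  have hcont : Continuous (toEuclideanLin M) := LinearMap.continuous_of_finiteDimensional _
  rw [charFun_apply, integral_map hcont.aemeasurable
    (Continuous.aestronglyMeasurable (by fun_prop))]
  simp only [hadj]
  rw [← charFun_apply, charFun_multivariateGaussian hV, charFun_multivariateGaussian hMV]
  simp only [inner_zero_right, toLpLin_apply]
  congr 4
  rw [← mulVec_mulVec, ← mulVec_mulVec, mulVec_transpose, ← dotProduct_mulVec]

/-- A version of the delta method: if `Y` is, with probability tending to one, linearly approximated
by `D` up to an error `ε ‖D‖` for every `ε`, and `r • D` converges in distribution, then `r • Y`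
converges in distribution to the image of the limit. -/
theorem tendstoInDistribution_smul_of_linearization {Ω Ω' ι E F : Type*} [MeasurableSpace Ω]
    [MeasurableSpace Ω'] {P : Measure Ω} [IsProbabilityMeasure P] {P' : Measure Ω'}
    [IsProbabilityMeasure P'] {l : Filter ι} [l.IsCountablyGenerated]
    [NormedAddCommGroup E] [NormedSpace ℝ E] [MeasurableSpace E] [BorelSpace E]
    [SecondCountableTopology E]
    [NormedAddCommGroup F] [NormedSpace ℝ F] [MeasurableSpace F] [BorelSpace F]
    [SecondCountableTopology F]
    (T : E →L[ℝ] F) {r : ι → ℝ} (hr : ∀ n, 0 ≤ r n) {D : ι → Ω → E} {Y : ι → Ω → F} {Z : Ω' → E}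
    (hD : ∀ n, AEMeasurable (D n) P) (hY : ∀ n, AEMeasurable (Y n) P)
    (hDZ : TendstoInDistribution (fun n ω => r n • D n ω) l Z (fun _ => P) P')
    (hlin : ∀ ε > 0, Tendsto (fun n => P {ω | ¬ ‖Y n ω - T (D n ω)‖ ≤ ε * ‖D n ω‖}) l (𝓝 0)) :
    TendstoInDistribution (fun n ω => r n • Y n ω) l (T ∘ Z) (fun _ => P) P' := by
  set U : ι → Ω → F := fun n ω => ‖D n ω‖⁻¹ • (Y n ω - T (D n ω)) with hU
  have hU_meas : ∀ n, AEMeasurable (U n) P := fun n =>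
    (hD n).norm.inv.smul ((hY n).sub (T.continuous.measurable.comp_aemeasurable (hD n)))
  have hU0 : TendstoInMeasure P U l fun _ => 0 := by
    rw [tendstoInMeasure_iff_norm]
    intro ε hε
    refine tendsto_of_tendsto_of_tendsto_of_le_of_le tendsto_const_nhds (hlin (ε / 2) (half_pos hε))
      (fun n => zero_le) fun n => measure_mono fun ω hω hcon => ?_
    simp only [Set.mem_ofPred_eq, sub_zero, hU, norm_smul, norm_inv, norm_norm] at hω
    have : ‖D n ω‖⁻¹ * ‖Y n ω - T (D n ω)‖ ≤ ε / 2 := by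
      rcases (norm_nonneg (D n ω)).eq_or_lt with h | h
      · rw [← h, _root_.inv_zero, zero_mul]; exact (half_pos hε).le
      · rw [inv_mul_le_iff₀ h, mul_comm]; exact hcon
    linarith
  have hlim := hDZ.continuous_comp_prodMk_of_tendstoInMeasure_const
    (g := fun z : E × F => T z.1 + ‖z.1‖ • z.2) (by fun_prop) hU0 hU_meas
  have hlim' : TendstoInDistribution (fun n ω => T (r n • D n ω) + ‖r n • D n ω‖ • U n ω) l (T ∘ Z)
      (fun _ => P) P' := by
    refine hlim.congr (fun _ => EventuallyEq.rfl) (Eventually.of_forall fun ω => ?_)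
    simp
  refine tendstoInDistribution_of_tendstoInMeasure_sub _ _ hlim' ?_
    fun n => (hY n).const_smul (r n)
  rw [tendstoInMeasure_iff_norm]
  intro ε hε
  refine tendsto_of_tendsto_of_tendsto_of_le_of_le tendsto_const_nhds (hlin 1 one_pos)
    (fun n => zero_le) fun n => measure_mono fun ω hω hcon => ?_
  refine hε.not_ge (hω.trans_eq ?_)
  have key : ‖D n ω‖ • U n ω = Y n ω - T (D n ω) := by
    rcases eq_or_ne (D n ω) 0 with h | h
    · have h0 : Y n ω - T (D n ω) = 0 := by simpa [h] using hcon
      rw [h0, h, norm_zero, zero_smul]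
    · rw [hU, smul_inv_smul₀ (norm_ne_zero_iff.2 h)]
  simp only [Pi.sub_apply, Pi.zero_apply, sub_zero, norm_smul, Real.norm_of_nonneg (hr n),
    map_smul, mul_smul, key]
  rw [← smul_add, add_sub_cancel, sub_self, norm_zero]

theorem mulVec_injective_of_rank_eq {I m : ℕ} {X : Matrix (Fin I) (Fin m) ℝ} (hX : X.rank = m) :
    Function.Injective X.mulVec := by
  have h := LinearMap.finrank_range_add_finrank_ker X.mulVecLin
  rw [← Matrix.rank, hX, Module.finrank_fin_fun, Nat.add_eq_left, Submodule.finrank_eq_zero] at h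
  exact LinearMap.ker_eq_bot.1 h

theorem relativeSize_pos {I : ℕ} {N : Fin I → ℝ} (hN : ∀ i, 0 < N i) (i : Fin I) :
    0 < relativeSize N i :=
  div_pos (hN i) (Finset.sum_pos (fun j _ => hN j) ⟨i, Finset.mem_univ i⟩)

/-- Convergence in probability to constants makes every neighbourhood of the limits likely. -/
theorem tendsto_measure_not_of_eventually_nhds {Ω ι E F : Type*} [MeasurableSpace Ω] {P : Measure Ω}
    {l : Filter ι} [PseudoMetricSpace E] [PseudoMetricSpace F] {f : ι → Ω → E} {g : ι → Ω → F}
    {a : E} {b : F} (hf : TendstoInMeasure P f l fun _ => a)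
    (hg : TendstoInMeasure P g l fun _ => b) {s : E × F → Prop} (hs : ∀ᶠ z in 𝓝 (a, b), s z) :
    Tendsto (fun n => P {ω | ¬ s (f n ω, g n ω)}) l (𝓝 0) := by
  obtain ⟨r, hr, hball⟩ := Metric.eventually_nhds_iff.1 hs
  have h := (tendstoInMeasure_iff_dist.1 hf r hr).add (tendstoInMeasure_iff_dist.1 hg r hr)
  rw [add_zero] at h
  refine tendsto_of_tendsto_of_tendsto_of_le_of_le tendsto_const_nhds h (fun n => zero_le)
    fun n => (measure_mono fun ω hω => ?_).trans (measure_union_le _ _)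
  by_contra hcon
  simp only [Set.mem_union, Set.mem_ofPred_eq, not_or, not_le] at hcon
  exact hω (hball (by rw [Prod.dist_eq]; exact max_lt hcon.1 hcon.2))

end PseudoPhi

theorem theorem1 {Ω : Type*} [MeasurableSpace Ω] (P : Measure Ω) [IsProbabilityMeasure P]
    {I k : ℕ} (x : Matrix (Fin I) (Fin k) ℝ) (hX : (PseudoPhi.design x).rank = k + 1)
    (N : Fin I → ℝ) (hN : ∀ i, 0 < N i)
    (β₀ : EuclideanSpace ℝ (Fin (k + 1)))
    (V : Matrix (Fin I) (Fin I) ℝ) (hV : V.PosSemidef)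
    (φ : ℝ → ℝ) (hφ : PseudoPhi.IsDivergenceFunction φ)
    -- survey estimators of the domain sizes and of the numbers of successes, at sample size `n`
    (Nhat Nhat₁ : ℕ → Ω → Fin I → ℝ)
    (hNhat_meas : ∀ n, AEMeasurable (Nhat n) P) (hNhat₁_meas : ∀ n, AEMeasurable (Nhat₁ n) P)
    (hNhat : ∀ n, ∀ᵐ ω ∂P, ∀ i, 0 ≤ Nhat₁ n ω i ∧ Nhat₁ n ω i ≤ Nhat n ω i)
    (hw : TendstoInMeasure P (fun n ω => PseudoPhi.relativeSize (Nhat n ω)) atTop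
      (fun _ => PseudoPhi.relativeSize N))
    (hp : TendstoInMeasure P (fun n ω => PseudoPhi.ratioEstimate (Nhat₁ n ω) (Nhat n ω)) atTop
      (fun _ => PseudoPhi.logisticProb (PseudoPhi.design x) β₀))
    (hclt : TendstoInDistribution
      (fun (n : ℕ) ω => √(n : ℝ) • (PseudoPhi.ratioEstimate (Nhat₁ n ω) (Nhat n ω) -
        PseudoPhi.logisticProb (PseudoPhi.design x) β₀))
      atTop id (fun _ => P) (multivariateGaussian 0 V))
    -- the estimator: a measurable random vector that is a minimizer whenever there is one
    (βhat : ℕ → Ω → EuclideanSpace ℝ (Fin (k + 1)))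
    (hβhat_meas : ∀ n, AEMeasurable (βhat n) P)
    (hβhat : ∀ n, ∀ᵐ ω ∂P,
      (∃ b, PseudoPhi.IsPseudoMinimizer φ (PseudoPhi.design x)
        (PseudoPhi.relativeSize (Nhat n ω)) (PseudoPhi.ratioEstimate (Nhat₁ n ω) (Nhat n ω)) b) →
      PseudoPhi.IsPseudoMinimizer φ (PseudoPhi.design x)
        (PseudoPhi.relativeSize (Nhat n ω)) (PseudoPhi.ratioEstimate (Nhat₁ n ω) (Nhat n ω))
        (βhat n ω)) :
    IsUnit ((PseudoPhi.design x)ᵀ *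
        PseudoPhi.Delta (PseudoPhi.relativeSize N)
          (PseudoPhi.logisticProb (PseudoPhi.design x) β₀) *
        PseudoPhi.design x).det ∧
    TendstoInDistribution (fun (n : ℕ) ω => √(n : ℝ) • (βhat n ω - β₀)) atTop id (fun _ => P)
      (multivariateGaussian 0
        (PseudoPhi.sandwich (PseudoPhi.design x) (PseudoPhi.relativeSize N)
          (PseudoPhi.logisticProb (PseudoPhi.design x) β₀) V)) := by
  have hinj := PseudoPhi.mulVec_injective_of_rank_eq hX
  have hW := PseudoPhi.relativeSize_pos hN
  have hq := PseudoPhi.logisticProb_mem_Ioo (PseudoPhi.design x) β₀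
  refine ⟨PseudoPhi.isUnit_det_information hinj hW hq, ?_⟩
  rw [PseudoPhi.sandwich_eq]
  set X := PseudoPhi.design x
  set q := PseudoPhi.logisticProb X β₀
  set W := PseudoPhi.relativeSize N
  set M := PseudoPhi.responseMatrix X W q
  have hp_meas : ∀ n, AEMeasurable
      (fun ω => PseudoPhi.ratioEstimate (Nhat₁ n ω) (Nhat n ω) - q) P := fun n =>
    ((PiLp.continuous_toLp 2 _).measurable.comp_aemeasurable (aemeasurable_pi_lambda _ fun i =>
      ((measurable_pi_apply i).comp_aemeasurable (hNhat₁_meas n)).div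
        ((measurable_pi_apply i).comp_aemeasurable (hNhat_meas n)))).sub_const q
  have main := PseudoPhi.tendstoInDistribution_smul_of_linearization
    (LinearMap.toContinuousLinearMap (toEuclideanLin M))
    (r := fun n : ℕ => √(n : ℝ)) (fun n => Real.sqrt_nonneg _) hp_meas
    (fun n => (hβhat_meas n).sub_const β₀) hclt fun ε hε => by
      refine tendsto_of_tendsto_of_tendsto_of_le_of_le tendsto_const_nhds
        (PseudoPhi.tendsto_measure_not_of_eventually_nhds hw hp
          (PseudoPhi.eventually_isPseudoMinimizer hφ hinj hW β₀ hε))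
        (fun n => zero_le) fun n => measure_mono_ae ?_
      filter_upwards [hβhat n] with ω hω hbad hgood
      exact hbad (hgood.2 _ (hω hgood.1))
  refine ⟨main.forall_aemeasurable, aemeasurable_id, ?_⟩
  refine main.tendsto.trans_eq (congrArg 𝓝 (Subtype.ext ?_))
  exact (PseudoPhi.map_toEuclideanLin_multivariateGaussian M hV).trans Measure.map_id.symm
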